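/- Let $\mathcal H,\mathcal U,\mathcal Y,\mathcal Z$ be Hilbert spaces over the same field ($\mathbb R$ or $\mathbb C$), let $A$ be the generator of a $C_0$-semigroup $(T(t))_{t\ge 0}$ on $\mathcal H$, let $B\in L(\mathcal U,\mathcal H)$, $C\in L(\mathcal H,\mathcal Y)$, $K\in L(\mathcal U,\mathcal Z)$, $z\in\mathcal H$, $v\in\mathcal U$, and assume that there is $c_K>0$ with $\|Ku\|\ge c_K\|Bu\|$ for all $u\in\mathcal U$. Put $$\ell(x,u)=\|Cx\|^2+\|Ku\|^2+2\operatorname{Re}\langle z,x\rangle+2\operatorname{Re}\langle v,u\rangle ,\qquad x\in\mathcal H,\ u\in\mathcal U,$$ and for $x_0\in\mathcal H$ and $u\in L^2_{\rm loc}([0,\infty),\mathcal U)$ denote by $$x_u(t;x_0)=T(t)x_0+\int_0^tT(t-s)Bu(s)\,ds,\qquad t\ge 0,$$ the mild solution of $\dot x=Ax+Bu$, $x(0)=x_0$. Let $(x_e,u_e)\in\operatorname{dom}A\times\mathcal U$ be a controlled equilibrium, i.e. $Ax_e+Bu_e=0$, let $V:\mathcal H\to\mathbb R$ be a storage function, i.e.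 continuously (real) Fréchet differentiable, and let $\alpha:[0,\infty)\to[0,\infty)$ be continuous and strictly increasing with $\alpha(0)=0$. Then the following are equivalent. (i) The optimal control problem with dynamics $\dot x=Ax+Bu$ and stage cost $\ell$ is strictly pre-dissipative at $(x_e,u_e)$ with storage function $V$ and dissipation rate $\alpha$, i.e. for all $x\in\operatorname{dom}A$ and all $u\in\mathcal U$, $$V'(x)(Ax+Bu)\le \ell(x,u)-\ell(x_e,u_e)-\alpha(\|x-x_e\|).$$ (ii) For all $x_0\in\mathcal H$, all $u\in L^2_{\rm loc}([0,\infty),\mathcal U)$ and all $0\le t_1<t_2$, $$V(x_u(t_2;x_0))-V(x_u(t_1;x_0))\le\int_{t_1}^{t_2}\big[\ell(x_u(t;x_0),u(t))-\ell(x_e,u_e)-\alpha(\|x_u(t;x_0)-x_e\|)\big]\,dt .$$ -/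

import Mathlib

open Filter Topology MeasureTheory
open scoped NNReal

noncomputable section

namespace LQ

/-- A `C₀`-semigroup of bounded `𝕜`-linear operators `T t`, `t ≥ 0`, on `H`.
The values of `T` at negative times are irrelevant. -/
structure C0Semigroup (𝕜 H : Type*) [RCLike 𝕜] [NormedAddCommGroup H]
    [InnerProductSpace 𝕜 H] where
  T : ℝ → H →L[𝕜] H
  map_zero : T 0 = ContinuousLinearMap.id 𝕜 H
  map_add : ∀ s t : ℝ, 0 ≤ s → 0 ≤ t → T (s + t) = (T s).comp (T t)
  tendsto_zero : ∀ x : H, Tendsto (fun t : ℝ => T t x) (𝓝[>] 0) (𝓝 x)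

/-- The (unbounded) operator `A` is the infinitesimal generator of `S`: its domain consists of
exactly those `x` for which `(S t x - x) / t` converges as `t ↓ 0`, and `A x` is this limit. -/
def IsGenerator {𝕜 H : Type*} [RCLike 𝕜] [NormedAddCommGroup H] [InnerProductSpace 𝕜 H]
    [NormedSpace ℝ H] (A : H →ₗ.[𝕜] H) (S : C0Semigroup 𝕜 H) : Prop :=
  ∀ x y : H, (x, y) ∈ A.graph ↔
    Tendsto (fun t : ℝ => t⁻¹ • (S.T t x - x)) (𝓝[>] 0) (𝓝 y)

/-- The data of a generalized linear-quadratic optimal control problem: the dynamics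
`x' = A x + B u`, where `A` generates a `C₀`-semigroup, and the coefficients `C, K, z, v` of the
stage cost, subject to `‖K u‖ ≥ c_K ‖B u‖` for some `c_K > 0`. -/
structure OCP (𝕜 H U Y Z : Type*) [RCLike 𝕜]
    [NormedAddCommGroup H] [InnerProductSpace 𝕜 H] [NormedSpace ℝ H]
    [NormedAddCommGroup U] [InnerProductSpace 𝕜 U]
    [NormedAddCommGroup Y] [InnerProductSpace 𝕜 Y]
    [NormedAddCommGroup Z] [InnerProductSpace 𝕜 Z] where
  A : H →ₗ.[𝕜] H
  S : C0Semigroup 𝕜 H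
  isGenerator : IsGenerator A S
  B : U →L[𝕜] H
  C : H →L[𝕜] Y
  K : U →L[𝕜] Z
  z : H
  v : U
  bound_KB : ∃ cK : ℝ, 0 < cK ∧ ∀ u : U, cK * ‖B u‖ ≤ ‖K u‖

/-- The comparison functions of class `𝒦`: continuous, strictly increasing, zero at zero. -/
structure ClassK (α : ℝ≥0 → ℝ≥0) : Prop where
  continuous : Continuous α
  strictMono : StrictMono α
  map_zero : α 0 = 0

/-- A storage function is a real-valued function that is `C¹` in the real Fréchet sense. -/
def IsStorageFunction {H : Type*} [NormedAddCommGroup H] [NormedSpace ℝ H] (V : H → ℝ) : Prop :=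
  ContDiff ℝ 1 V

/-- `u ∈ L²_loc([0,∞), U)`; the values of `u` at negative times are irrelevant. -/
def IsL2Loc {U : Type*} [NormedAddCommGroup U] (u : ℝ → U) : Prop :=
  ∀ τ : ℝ, MemLp u 2 (volume.restrict (Set.Icc 0 τ))

namespace OCP

variable {𝕜 H U Y Z : Type*} [RCLike 𝕜]
  [NormedAddCommGroup H] [InnerProductSpace 𝕜 H] [NormedSpace ℝ H]
  [NormedAddCommGroup U] [InnerProductSpace 𝕜 U]
  [NormedAddCommGroup Y] [InnerProductSpace 𝕜 Y]
  [NormedAddCommGroup Z] [InnerProductSpace 𝕜 Z]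

/-- The stage cost `ℓ(x,u) = ‖Cx‖² + ‖Ku‖² + 2 Re⟨z,x⟩ + 2 Re⟨v,u⟩`. -/
def cost (P : OCP 𝕜 H U Y Z) (x : H) (u : U) : ℝ :=
  ‖P.C x‖ ^ 2 + ‖P.K u‖ ^ 2 + 2 * RCLike.re (inner 𝕜 P.z x) + 2 * RCLike.re (inner 𝕜 P.v u)

/-- `(xₑ, uₑ) ∈ dom A × U` with `A xₑ + B uₑ = 0`. -/
def IsControlledEquilibrium (P : OCP 𝕜 H U Y Z) (xe : H) (ue : U) : Prop :=
  ∃ hx : xe ∈ P.A.domain, P.A ⟨xe, hx⟩ + P.B ue = 0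

/-- The mild solution `x_u(t; x₀) = T(t) x₀ + ∫₀ᵗ T(t-s) B u(s) ds` (for `t ≥ 0`). -/
def mildSolution (P : OCP 𝕜 H U Y Z) (u : ℝ → U) (x₀ : H) (t : ℝ) : H :=
  P.S.T t x₀ + ∫ s in (0 : ℝ)..t, P.S.T (t - s) (P.B (u s))

/-- Strict pre-dissipativity at the controlled equilibrium `(xₑ, uₑ)` with the storage function
`V` and the dissipation rate `α`. -/
structure IsStrictlyPreDissipativeWith (P : OCP 𝕜 H U Y Z) (xe : H) (ue : U)
    (V : H → ℝ) (α : ℝ≥0 → ℝ≥0) : Prop where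
  equilibrium : P.IsControlledEquilibrium xe ue
  storage : IsStorageFunction V
  rate : ClassK α
  dissipation : ∀ (x : P.A.domain) (u : U),
    fderiv ℝ V x (P.A x + P.B u) ≤
      P.cost x u - P.cost xe ue - (α ‖(x : H) - xe‖₊ : ℝ)

end OCP

end LQ

end

/-! Inequality (i) is the time derivative of (ii). For (ii) ⇒ (i), a constant control and a start in
dom `A` give a trajectory with right derivative `A x + B u` at time 0; dividing (ii) by `t` and
letting `t ↓ 0` yields (i).

For (i) ⇒ (ii) the difficulty is that a mild solution need not lie in dom `A`, nor be
differentiable. For continuous controls the trajectory is therefore smoothed by `S.avg h`. These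
averages map into dom `A` (`tendsto_slope_avg`) and commute with the semigroup, so the smoothed
trajectory is a mild solution for smoothed data (`avg_mild`) and is right differentiable
(`hasDerivWithinAt_mild`). Applying (i) along it, with an error from smoothing `B u`, integrating
and letting `h ↓ 0` gives `integral_dissipation_of_continuous`.

Square integrable controls are then approximated in L² by continuous ones. The states converge
uniformly (`tendstoUniformlyOn_mild`). As the cost has no mixed term, its state part converges by
continuity and its control part by a quadratic estimate (`tendsto_integral_cost_zero`). -/

noncomputable section

namespace LQ

/-! ### Semigroups: local boundedness and joint strong continuity. -/

namespace C0Semigroup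

variable {𝕜 H : Type*} [RCLike 𝕜] [NormedAddCommGroup H] [InnerProductSpace 𝕜 H]

/-- The operators of a `C₀`-semigroup are uniformly bounded near `0`. -/
theorem exists_bound_near_zero [CompleteSpace H] (S : C0Semigroup 𝕜 H) :
    ∃ δ : ℝ, 0 < δ ∧ ∃ M : ℝ, ∀ t ∈ Set.Icc 0 δ, ‖S.T t‖ ≤ M := by
  by_contra! hcon
  have hpos (n : ℕ) : (0 : ℝ) < 1 / ((n : ℝ) + 1) := by positivity
  -- The summand `‖S.T 0‖` in the threshold forces `t n ≠ 0`, so the times approach 0 strictly from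
  -- the right, where strong continuity applies.
  choose t ht hlt using fun n : ℕ => hcon (1 / ((n : ℝ) + 1)) (hpos n) (n + 1 + ‖S.T 0‖)
  have htpos (n : ℕ) : 0 < t n := by
    refine lt_of_le_of_ne (ht n).1 fun h => ?_
    have h₁ := hlt n
    rw [← h] at h₁
    have : (0 : ℝ) ≤ n := n.cast_nonneg
    linarith
  have hlim : Tendsto t atTop (𝓝[>] 0) :=
    tendsto_nhdsWithin_iff.2
      ⟨squeeze_zero (fun n => (ht n).1) (fun n => (ht n).2)
        tendsto_one_div_add_atTop_nhds_zero_nat, Eventually.of_forall htpos⟩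
  obtain ⟨C, hC⟩ := banach_steinhaus (g := fun n => S.T (t n)) fun x => by
    obtain ⟨C, hC⟩ := (Metric.isBounded_range_of_tendsto _
      ((S.tendsto_zero x).comp hlim)).exists_norm_le
    exact ⟨C, fun n => hC _ ⟨n, rfl⟩⟩
  obtain ⟨n, hn⟩ := exists_nat_gt C
  have h₁ := hlt n
  have h₂ := hC n
  have h₃ := norm_nonneg (S.T 0)
  linarith

/-- The operators of a `C₀`-semigroup are uniformly bounded on compact time intervals. -/
theorem exists_bound [CompleteSpace H] (S : C0Semigroup 𝕜 H) (τ : ℝ) :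
    ∃ M : ℝ, 0 ≤ M ∧ ∀ t ∈ Set.Icc 0 τ, ‖S.T t‖ ≤ M := by
  obtain ⟨δ, hδ, M, hM⟩ := S.exists_bound_near_zero
  have hM0 : 0 ≤ M := (norm_nonneg _).trans (hM 0 ⟨le_rfl, hδ.le⟩)
  have key (n : ℕ) : ∃ N : ℝ, 0 ≤ N ∧ ∀ t ∈ Set.Icc 0 (n * δ), ‖S.T t‖ ≤ N := by
    induction n with
    | zero =>
      refine ⟨M, hM0, fun t ht => hM t ⟨ht.1, ht.2.trans ?_⟩⟩
      simpa using hδ.le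
    | succ n ih =>
      obtain ⟨N, hN0, hN⟩ := ih
      refine ⟨M + M * N, by positivity, fun t ht => ?_⟩
      rcases le_total t δ with h | h
      · exact (hM t ⟨ht.1, h⟩).trans (le_add_of_nonneg_right (by positivity))
      · have ht2 : t ≤ (n + 1) * δ := by simpa using ht.2
        have hsplit : S.T t = (S.T δ).comp (S.T (t - δ)) := by
          rw [← S.map_add δ (t - δ) hδ.le (by linarith)]
          congr 1
          ring
        calc ‖S.T t‖ ≤ ‖S.T δ‖ * ‖S.T (t - δ)‖ := hsplit ▸ ContinuousLinearMap.opNorm_comp_le _ _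
          _ ≤ M * N := mul_le_mul (hM δ ⟨hδ.le, le_rfl⟩)
              (hN _ ⟨by linarith, by linarith⟩) (norm_nonneg _) hM0
          _ ≤ M + M * N := le_add_of_nonneg_left hM0
  obtain ⟨n, hn⟩ := exists_nat_gt (τ / δ)
  obtain ⟨N, hN0, hN⟩ := key n
  exact ⟨N, hN0, fun t ht => hN t ⟨ht.1, ht.2.trans ((div_lt_iff₀ hδ).1 hn).le⟩⟩

variable [NormedSpace ℝ H] [IsScalarTower ℝ 𝕜 H]

/-- The semigroup as a family of real-linear operators, extended by the identity to negative
times. -/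
def ext (S : C0Semigroup 𝕜 H) (t : ℝ) : H →L[ℝ] H :=
  (S.T (max t 0)).restrictScalars ℝ

theorem ext_apply (S : C0Semigroup 𝕜 H) {t : ℝ} (ht : 0 ≤ t) (x : H) : S.ext t x = S.T t x := by
  simp [ext, max_eq_left ht]

theorem ext_zero_apply (S : C0Semigroup 𝕜 H) (x : H) : S.ext 0 x = x := by
  simp [ext, S.map_zero]

theorem ext_add_apply (S : C0Semigroup 𝕜 H) {s t : ℝ} (hs : 0 ≤ s) (ht : 0 ≤ t) (x : H) :
    S.ext (s + t) x = S.ext s (S.ext t x) := by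
  rw [S.ext_apply (add_nonneg hs ht), S.ext_apply hs, S.ext_apply ht, S.map_add s t hs ht]
  rfl

theorem exists_ext_bound [CompleteSpace H] (S : C0Semigroup 𝕜 H) (τ : ℝ) :
    ∃ M : ℝ, 0 ≤ M ∧ ∀ t ≤ τ, ∀ x, ‖S.ext t x‖ ≤ M * ‖x‖ := by
  obtain ⟨M, hM0, hM⟩ := S.exists_bound (max τ 0)
  refine ⟨M, hM0, fun t ht x => ?_⟩
  exact (S.T (max t 0)).le_of_opNorm_le (hM _ ⟨le_max_right _ _, max_le_max_right 0 ht⟩) x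

theorem tendsto_ext_zero (S : C0Semigroup 𝕜 H) (x : H) :
    Tendsto (fun t => S.ext t x) (𝓝 0) (𝓝 x) := by
  rw [← nhdsLE_sup_nhdsGT]
  refine Tendsto.sup ?_ ?_
  · refine tendsto_const_nhds.congr' ?_
    filter_upwards [self_mem_nhdsWithin] with t ht
    simp [ext, max_eq_right (show t ≤ 0 from ht), S.map_zero]
  · refine (S.tendsto_zero x).congr' ?_
    filter_upwards [self_mem_nhdsWithin] with t ht
    rw [S.ext_apply (le_of_lt ht)]

/-- Factoring out the operator at the smaller time leaves a difference at time 0, which reduces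
strong continuity everywhere to `tendsto_ext_zero`. The positive parts appear because `ext` is
constant on negative times. -/
theorem norm_ext_sub_ext_le [CompleteSpace H] (S : C0Semigroup 𝕜 H) (τ : ℝ) :
    ∃ M : ℝ, 0 ≤ M ∧ ∀ s ≤ τ, ∀ t ≤ τ, ∀ x,
      ‖S.ext s x - S.ext t x‖ ≤ M * ‖S.ext |max s 0 - max t 0| x - x‖ := by
  obtain ⟨M, hM0, hM⟩ := S.exists_ext_bound τ
  have hmax (t : ℝ) : S.ext (max t 0) = S.ext t := by simp [ext]
  have aux : ∀ s ≤ τ, ∀ t ≤ τ, max s 0 ≤ max t 0 → ∀ x,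
      ‖S.ext s x - S.ext t x‖ ≤ M * ‖S.ext |max s 0 - max t 0| x - x‖ := by
    intro s hs t ht hst x
    have h : S.ext t x = S.ext s (S.ext |max s 0 - max t 0| x) := by
      rw [← hmax s, ← S.ext_add_apply (le_max_right _ _) (abs_nonneg _), ← hmax t,
        abs_of_nonpos (by linarith)]
      congr 2
      ring
    rw [h, ← map_sub, norm_sub_rev _ x]
    exact hM s hs _
  refine ⟨M, hM0, fun s hs t ht x => ?_⟩
  rcases le_total (max s 0) (max t 0) with h | h
  · exact aux s hs t ht h x
  · rw [norm_sub_rev, abs_sub_comm]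
    exact aux t ht s hs h x

/-- Joint strong continuity of a `C₀`-semigroup. -/
theorem continuous_ext [CompleteSpace H] (S : C0Semigroup 𝕜 H) :
    Continuous fun p : ℝ × H => S.ext p.1 p.2 := by
  rw [continuous_iff_continuousAt]
  rintro ⟨t, x⟩
  obtain ⟨M, hM0, hM⟩ := S.exists_ext_bound (t + 1)
  obtain ⟨N, hN0, hN⟩ := S.norm_ext_sub_ext_le (t + 1)
  rw [ContinuousAt, tendsto_iff_norm_sub_tendsto_zero]
  have hlim : Tendsto (fun p : ℝ × H =>
      M * ‖p.2 - x‖ + N * ‖S.ext |max p.1 0 - max t 0| x - x‖) (𝓝 (t, x)) (𝓝 0) := by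
    have h₁ : Tendsto (fun p : ℝ × H => ‖p.2 - x‖) (𝓝 (t, x)) (𝓝 0) := by
      have : Continuous fun p : ℝ × H => ‖p.2 - x‖ := by fun_prop
      simpa using this.tendsto (t, x)
    have h₂ : Tendsto (fun p : ℝ × H => |max p.1 0 - max t 0|) (𝓝 (t, x)) (𝓝 0) := by
      have : Continuous fun p : ℝ × H => |max p.1 0 - max t 0| := by fun_prop
      simpa using this.tendsto (t, x)
    have h₃ := tendsto_iff_norm_sub_tendsto_zero.1 ((S.tendsto_ext_zero x).comp h₂)
    simpa using (h₁.const_mul M).add (h₃.const_mul N)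
  refine squeeze_zero' (Eventually.of_forall fun _ => norm_nonneg _) ?_ hlim
  have hev : ∀ᶠ p : ℝ × H in 𝓝 (t, x), p.1 < t + 1 :=
    continuous_fst.continuousAt.eventually_lt continuousAt_const (by simp)
  filter_upwards [hev] with p hp
  calc ‖S.ext p.1 p.2 - S.ext t x‖
      = ‖S.ext p.1 (p.2 - x) + (S.ext p.1 x - S.ext t x)‖ := by rw [map_sub]; congr 1; abel
    _ ≤ ‖S.ext p.1 (p.2 - x)‖ + ‖S.ext p.1 x - S.ext t x‖ := norm_add_le _ _
    _ ≤ _ := add_le_add (hM _ hp.le _) (hN _ hp.le _ (by linarith) _)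

theorem continuous_ext_apply [CompleteSpace H] (S : C0Semigroup 𝕜 H) {X : Type*}
    [TopologicalSpace X] {r : X → ℝ} {y : X → H} (hr : Continuous r) (hy : Continuous y) :
    Continuous fun p => S.ext (r p) (y p) :=
  S.continuous_ext.comp (hr.prodMk hy)

/-! ### Averages of the semigroup and their regularizing effect. -/

/-- The averages `h⁻¹ ∫₀ʰ T(s) ds` of a `C₀`-semigroup, written as `∫₀¹ T(h σ) dσ` so that `h = 0`
is included. -/
def avg [CompleteSpace H] (S : C0Semigroup 𝕜 H) (h : ℝ) : H →L[ℝ] H where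
  toFun y := ∫ σ in (0 : ℝ)..1, S.ext (h * σ) y
  map_add' y y' := by
    have hint (w : H) : IntervalIntegrable (fun σ : ℝ => S.ext (h * σ) w) volume 0 1 :=
      (S.continuous_ext_apply (continuous_const_mul h) continuous_const).intervalIntegrable 0 1
    simp only [_root_.map_add]
    exact intervalIntegral.integral_add (hint y) (hint y')
  map_smul' c y := by
    simp only [map_smul, RingHom.id_apply]
    exact intervalIntegral.integral_smul c _
  cont := intervalIntegral.continuous_parametric_intervalIntegral_of_continuous'
    (S.continuous_ext_apply (by fun_prop) (by fun_prop)) 0 1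

end C0Semigroup

namespace C0Semigroup

variable {𝕜 H : Type*} [RCLike 𝕜] [NormedAddCommGroup H] [InnerProductSpace 𝕜 H]
  [NormedSpace ℝ H] [IsScalarTower ℝ 𝕜 H]

section Avg

variable [CompleteSpace H]

theorem avg_apply (S : C0Semigroup 𝕜 H) (h : ℝ) (y : H) :
    S.avg h y = ∫ σ in (0 : ℝ)..1, S.ext (h * σ) y := rfl

theorem avg_zero_apply (S : C0Semigroup 𝕜 H) (y : H) : S.avg 0 y = y := by
  simp [avg_apply, ext_zero_apply]

theorem continuous_avg (S : C0Semigroup 𝕜 H) : Continuous fun p : ℝ × H => S.avg p.1 p.2 :=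
  intervalIntegral.continuous_parametric_intervalIntegral_of_continuous'
    (f := fun (p : ℝ × H) (σ : ℝ) => S.ext (p.1 * σ) p.2)
    (S.continuous_ext_apply (by fun_prop) (by fun_prop)) 0 1

theorem continuous_avg_apply (S : C0Semigroup 𝕜 H) {X : Type*}
    [TopologicalSpace X] {r : X → ℝ} {y : X → H} (hr : Continuous r) (hy : Continuous y) :
    Continuous fun p => S.avg (r p) (y p) :=
  S.continuous_avg.comp (hr.prodMk hy)

theorem avg_eq_smul_integral (S : C0Semigroup 𝕜 H) {h : ℝ} (hh : h ≠ 0) (y : H) :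
    S.avg h y = h⁻¹ • ∫ s in (0 : ℝ)..h, S.ext s y := by
  rw [avg_apply, intervalIntegral.integral_comp_mul_left (fun s => S.ext s y) hh]
  simp

theorem ext_avg_comm (S : C0Semigroup 𝕜 H) {h t : ℝ} (hh : 0 ≤ h) (ht : 0 ≤ t) (y : H) :
    S.ext t (S.avg h y) = S.avg h (S.ext t y) := by
  rw [avg_apply, avg_apply, ← ContinuousLinearMap.intervalIntegral_comp_comm _
    ((S.continuous_ext_apply (continuous_const_mul h) continuous_const).intervalIntegrable 0 1)]
  refine intervalIntegral.integral_congr fun σ hσ => ?_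
  rw [Set.uIcc_of_le zero_le_one] at hσ
  have hσ0 : 0 ≤ h * σ := mul_nonneg hh hσ.1
  rw [← S.ext_add_apply ht hσ0, ← S.ext_add_apply hσ0 ht, add_comm]

/-- The averages take values in the domain of the generator: `S.ext t` shifts the window `[0, h]` to
`[t, t + h]`, so the quotient is a difference of slopes of the primitive `F` at `h` and at 0. -/
theorem tendsto_slope_avg (S : C0Semigroup 𝕜 H) {h : ℝ} (hh : 0 < h) (y : H) :
    Tendsto (fun t : ℝ => t⁻¹ • (S.ext t (S.avg h y) - S.avg h y)) (𝓝[>] 0)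
      (𝓝 (h⁻¹ • (S.ext h y - y))) := by
  set F : ℝ → H := fun r => ∫ s in (0 : ℝ)..r, S.ext s y with hF
  have hcont : Continuous fun s => S.ext s y := S.continuous_ext_apply continuous_id continuous_const
  have hderiv (r : ℝ) : HasDerivAt F (S.ext r y) r :=
    intervalIntegral.integral_hasDerivAt_right (hcont.intervalIntegrable _ _)
      (hcont.stronglyMeasurableAtFilter _ _) hcont.continuousAt
  have hslope (r : ℝ) :
      Tendsto (fun t : ℝ => t⁻¹ • (F (r + t) - F r)) (𝓝[>] 0) (𝓝 (S.ext r y)) :=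
    (hderiv r).tendsto_slope_zero_right
  have h0 : F 0 = 0 := by simp [hF]
  have hlim := ((hslope h).sub (hslope 0)).const_smul h⁻¹
  rw [S.ext_zero_apply] at hlim
  refine hlim.congr' ?_
  filter_upwards [self_mem_nhdsWithin] with t ht
  have ht0 : (0 : ℝ) ≤ t := le_of_lt ht
  have hTF : S.ext t (F h) = F (h + t) - F t := by
    rw [hF]
    simp only
    rw [← ContinuousLinearMap.intervalIntegral_comp_comm _ (hcont.intervalIntegrable 0 h),
      intervalIntegral.integral_interval_sub_left (hcont.intervalIntegrable _ _)
        (hcont.intervalIntegrable _ _)]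
    have hsub := intervalIntegral.integral_comp_add_left (a := 0) (b := h) (fun s => S.ext s y) t
    rw [add_zero, add_comm t h] at hsub
    rw [← hsub]
    refine intervalIntegral.integral_congr fun s hs => ?_
    rw [Set.uIcc_of_le hh.le] at hs
    exact (S.ext_add_apply ht0 hs.1 y).symm
  have havg : S.avg h y = h⁻¹ • F h := S.avg_eq_smul_integral hh.ne' y
  rw [havg, map_smul, hTF, h0, zero_add, ← smul_sub, ← smul_sub, smul_comm t⁻¹ h⁻¹]
  congr 2
  abel

end Avg

/-! ### Mild solutions with continuous inhomogeneity. -/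

/-- The mild solution of `x' = A x + f`, `x(0) = x₀`. -/
def mild (S : C0Semigroup 𝕜 H) (x₀ : H) (f : ℝ → H) (t : ℝ) : H :=
  S.ext t x₀ + ∫ s in (0 : ℝ)..t, S.ext (t - s) (f s)

theorem mild_zero (S : C0Semigroup 𝕜 H) (x₀ : H) (f : ℝ → H) : S.mild x₀ f 0 = x₀ := by
  simp [mild, ext_zero_apply]

variable [CompleteSpace H]

theorem continuous_mild (S : C0Semigroup 𝕜 H) (x₀ : H) {f : ℝ → H} (hf : Continuous f) :
    Continuous (S.mild x₀ f) :=
  (S.continuous_ext_apply continuous_id continuous_const).add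
    (intervalIntegral.continuous_parametric_intervalIntegral_of_continuous
      (f := fun t s => S.ext (t - s) (f s))
      (S.continuous_ext_apply (by fun_prop) (by fun_prop)) continuous_id)

theorem avg_mild (S : C0Semigroup 𝕜 H) (x₀ : H) {f : ℝ → H} (hf : Continuous f) {h t : ℝ}
    (hh : 0 ≤ h) (ht : 0 ≤ t) :
    S.avg h (S.mild x₀ f t) = S.mild (S.avg h x₀) (fun s => S.avg h (f s)) t := by
  have hc : Continuous fun s => S.ext (t - s) (f s) :=
    S.continuous_ext_apply (by fun_prop) hf
  rw [mild, mild, _root_.map_add, S.ext_avg_comm hh ht,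
    ← ContinuousLinearMap.intervalIntegral_comp_comm _ (hc.intervalIntegrable 0 t)]
  congr 1
  refine intervalIntegral.integral_congr fun s hs => ?_
  rw [Set.uIcc_of_le ht] at hs
  exact (S.ext_avg_comm hh (sub_nonneg.2 hs.2) _).symm

/-- The evolution property of mild solutions, the contribution of `f` on the last time interval
being rescaled to `[0, 1]`. -/
theorem mild_add (S : C0Semigroup 𝕜 H) (x₀ : H) {f : ℝ → H} (hf : Continuous f) {t δ : ℝ}
    (ht : 0 ≤ t) (hδ : 0 < δ) :
    S.mild x₀ f (t + δ) = S.ext δ (S.mild x₀ f t) +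
      δ • ∫ σ in (0 : ℝ)..1, S.ext (δ - δ * σ) (f (t + δ * σ)) := by
  have hc (r : ℝ) : Continuous fun s => S.ext (r - s) (f s) :=
    S.continuous_ext_apply (by fun_prop) hf
  have h₁ : ∫ s in (0 : ℝ)..t, S.ext (t + δ - s) (f s) =
      S.ext δ (∫ s in (0 : ℝ)..t, S.ext (t - s) (f s)) := by
    rw [← ContinuousLinearMap.intervalIntegral_comp_comm _ ((hc t).intervalIntegrable 0 t)]
    refine intervalIntegral.integral_congr fun s hs => ?_
    rw [Set.uIcc_of_le ht] at hs
    rw [← S.ext_add_apply hδ.le (sub_nonneg.2 hs.2)]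
    congr 2
    ring
  have h₂ : ∫ s in t..(t + δ), S.ext (t + δ - s) (f s) =
      δ • ∫ σ in (0 : ℝ)..1, S.ext (δ - δ * σ) (f (t + δ * σ)) := by
    have h := intervalIntegral.smul_integral_comp_add_mul (a := 0) (b := 1)
      (fun s => S.ext (t + δ - s) (f s)) δ t
    simp only [mul_zero, add_zero, mul_one, add_sub_add_left_eq_sub] at h
    exact h.symm
  rw [mild, ← intervalIntegral.integral_add_adjacent_intervals
    ((hc (t + δ)).intervalIntegrable 0 t) ((hc (t + δ)).intervalIntegrable t (t + δ)), h₁, h₂,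
    mild, _root_.map_add, add_comm t δ, S.ext_add_apply hδ.le ht, add_assoc]

/-- A mild solution with continuous inhomogeneity is differentiable from the right at every time
at which it is in the domain of the generator. -/
theorem hasDerivWithinAt_mild (S : C0Semigroup 𝕜 H) (x₀ : H) {f : ℝ → H} (hf : Continuous f)
    {t : ℝ} (ht : 0 ≤ t) {a : H}
    (ha : Tendsto (fun δ : ℝ => δ⁻¹ • (S.ext δ (S.mild x₀ f t) - S.mild x₀ f t)) (𝓝[>] 0) (𝓝 a)) :
    HasDerivWithinAt (S.mild x₀ f) (a + f t) (Set.Ioi t) t := by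
  -- After rescaling, the last-interval contribution divided by `δ` is continuous in `δ` up to `δ =
  -- 0`, where it equals `f t`.
  have hW : Continuous fun δ : ℝ => ∫ σ in (0 : ℝ)..1, S.ext (δ - δ * σ) (f (t + δ * σ)) :=
    intervalIntegral.continuous_parametric_intervalIntegral_of_continuous'
      (f := fun δ σ => S.ext (δ - δ * σ) (f (t + δ * σ)))
      (S.continuous_ext_apply (by fun_prop) (by fun_prop)) 0 1
  have hW0 := (hW.tendsto 0).mono_left (nhdsWithin_le_nhds (s := Set.Ioi (0 : ℝ)))
  simp only [zero_mul, sub_zero, add_zero, ext_zero_apply, intervalIntegral.integral_const,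
    one_smul] at hW0
  have hlim : Tendsto (fun δ : ℝ => δ⁻¹ • (S.mild x₀ f (t + δ) - S.mild x₀ f t)) (𝓝[>] 0)
      (𝓝 (a + f t)) := by
    refine (ha.add hW0).congr' ?_
    filter_upwards [self_mem_nhdsWithin] with δ hδ
    have hδ' : (0 : ℝ) < δ := hδ
    rw [S.mild_add x₀ hf ht hδ', add_sub_right_comm, smul_add, inv_smul_smul₀ hδ'.ne']
  rw [hasDerivWithinAt_iff_tendsto_slope' (by simp)]
  have hmap : Tendsto (fun s : ℝ => s - t) (𝓝[>] t) (𝓝[>] 0) := by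
    refine tendsto_nhdsWithin_iff.2 ⟨?_, ?_⟩
    · have : Continuous fun s : ℝ => s - t := by fun_prop
      simpa using (this.tendsto t).mono_left (nhdsWithin_le_nhds (s := Set.Ioi t))
    · filter_upwards [self_mem_nhdsWithin] with s hs
      exact sub_pos.2 (Set.mem_Ioi.1 hs)
  refine (hlim.comp hmap).congr fun s => ?_
  simp [slope_def_module]

end C0Semigroup

/-! ### Dissipation along trajectories with constant and with continuous controls. -/

theorem continuous_rate {H : Type*} [NormedAddCommGroup H] {α : ℝ≥0 → ℝ≥0} (hα : Continuous α) {X : Type*} [TopologicalSpace X]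
    {x : X → H} (hx : Continuous x) (xe : H) : Continuous fun p => (α ‖x p - xe‖₊ : ℝ) :=
  NNReal.continuous_coe.comp (hα.comp (hx.sub continuous_const).nnnorm)

namespace OCP

variable {𝕜 H U Y Z : Type*} [RCLike 𝕜]
  [NormedAddCommGroup H] [InnerProductSpace 𝕜 H] [NormedSpace ℝ H]
  [NormedAddCommGroup U] [InnerProductSpace 𝕜 U]
  [NormedAddCommGroup Y] [InnerProductSpace 𝕜 Y]
  [NormedAddCommGroup Z] [InnerProductSpace 𝕜 Z]

theorem continuous_cost (P : OCP 𝕜 H U Y Z) {X : Type*} [TopologicalSpace X] {x : X → H}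
    {u : X → U} (hx : Continuous x) (hu : Continuous u) :
    Continuous fun p => P.cost (x p) (u p) := by
  unfold cost
  have h₁ : Continuous fun p => inner 𝕜 P.z (x p) := continuous_const.inner hx
  have h₂ : Continuous fun p => inner 𝕜 P.v (u p) := continuous_const.inner hu
  have h₃ := RCLike.continuous_re.comp h₁
  have h₄ := RCLike.continuous_re.comp h₂
  simp only [Function.comp_def] at h₃ h₄
  fun_prop

variable [IsScalarTower ℝ 𝕜 H]

theorem mem_graph_iff (P : OCP 𝕜 H U Y Z) {x y : H} : (x, y) ∈ P.A.graph ↔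
    Tendsto (fun t : ℝ => t⁻¹ • (P.S.ext t x - x)) (𝓝[>] 0) (𝓝 y) := by
  rw [P.isGenerator x y]
  refine tendsto_congr' ?_
  filter_upwards [self_mem_nhdsWithin] with t ht
  rw [P.S.ext_apply (le_of_lt (Set.mem_Ioi.1 ht))]

theorem mildSolution_eq_mild (P : OCP 𝕜 H U Y Z) (u : ℝ → U) (x₀ : H) {t : ℝ} (ht : 0 ≤ t) :
    P.mildSolution u x₀ t = P.S.mild x₀ (fun s => P.B (u s)) t := by
  rw [mildSolution, C0Semigroup.mild, P.S.ext_apply ht]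
  congr 1
  refine intervalIntegral.integral_congr fun s hs => ?_
  rw [Set.uIcc_of_le ht] at hs
  exact (P.S.ext_apply (sub_nonneg.2 hs.2) _).symm

variable [CompleteSpace H]

/-- The dissipation inequality along the trajectories with constant control implies the
infinitesimal one. -/
theorem fderiv_le_of_integral_dissipation (P : OCP 𝕜 H U Y Z) {xe : H} {ue : U} {V : H → ℝ}
    {α : ℝ≥0 → ℝ≥0} (hV : Differentiable ℝ V) (hα : Continuous α) (x : P.A.domain) (u : U)
    (hdiss : ∀ t : ℝ, 0 < t →
      V (P.mildSolution (fun _ => u) x t) - V (P.mildSolution (fun _ => u) x 0) ≤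
        ∫ s in (0 : ℝ)..t, (P.cost (P.mildSolution (fun _ => u) x s) u - P.cost xe ue
          - (α ‖P.mildSolution (fun _ => u) x s - xe‖₊ : ℝ))) :
    fderiv ℝ V x (P.A x + P.B u) ≤
      P.cost x u - P.cost xe ue - (α ‖(x : H) - xe‖₊ : ℝ) := by
  set m : ℝ → H := P.S.mild (x : H) (fun _ => P.B u) with hm
  have hm0 : m 0 = x := P.S.mild_zero _ _
  have hmc : Continuous m := P.S.continuous_mild _ continuous_const
  have hmd : HasDerivWithinAt m (P.A x + P.B u) (Set.Ioi 0) 0 := by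
    refine P.S.hasDerivWithinAt_mild (x : H) (f := fun _ => P.B u) continuous_const le_rfl ?_
    rw [P.S.mild_zero]
    exact P.mem_graph_iff.1 (P.A.mem_graph x)
  set φ : ℝ → ℝ := fun s => P.cost (m s) u - P.cost xe ue - (α ‖m s - xe‖₊ : ℝ) with hφ
  have hφc : Continuous φ :=
    ((P.continuous_cost hmc continuous_const).sub continuous_const).sub (continuous_rate hα hmc xe)
  have hVd : HasDerivWithinAt (fun t => V (m t)) (fderiv ℝ V x (P.A x + P.B u)) (Set.Ioi 0) 0 := by
    have hf := (hV (m 0)).hasFDerivAt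
    have := hf.comp_hasDerivWithinAt (0 : ℝ) hmd
    rwa [hm0] at this
  have hΦd : HasDerivWithinAt (fun t => ∫ s in (0 : ℝ)..t, φ s) (φ 0) (Set.Ioi 0) 0 :=
    (intervalIntegral.integral_hasDerivAt_right (hφc.intervalIntegrable _ _)
      (hφc.stronglyMeasurableAtFilter _ _) hφc.continuousAt).hasDerivWithinAt
  have hle : fderiv ℝ V x (P.A x + P.B u) ≤ φ 0 := by
    rw [hasDerivWithinAt_iff_tendsto_slope' (by simp)] at hVd hΦd
    refine le_of_tendsto_of_tendsto hVd hΦd ?_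
    filter_upwards [self_mem_nhdsWithin] with t ht
    have ht0 : (0 : ℝ) < t := ht
    have h := hdiss t ht0
    rw [P.mildSolution_eq_mild _ _ ht0.le, P.mildSolution_eq_mild _ _ le_rfl] at h
    have hint : ∫ s in (0 : ℝ)..t, (P.cost (P.mildSolution (fun _ => u) x s) u - P.cost xe ue
          - (α ‖P.mildSolution (fun _ => u) x s - xe‖₊ : ℝ)) = ∫ s in (0 : ℝ)..t, φ s := by
      refine intervalIntegral.integral_congr fun s hs => ?_
      rw [Set.uIcc_of_le ht0.le] at hs
      simp only [hφ, P.mildSolution_eq_mild _ _ hs.1, hm]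
    rw [hint] at h
    simp only [slope_def_field, sub_zero, intervalIntegral.integral_same]
    exact div_le_div_of_nonneg_right h ht0.le
  simpa only [hφ, hm0] using hle

/-- The infinitesimal dissipation inequality implies the one along trajectories with continuous
control. -/
theorem integral_dissipation_of_continuous (P : OCP 𝕜 H U Y Z) {xe : H} {ue : U} {V : H → ℝ}
    {α : ℝ≥0 → ℝ≥0} (hV : ContDiff ℝ 1 V) (hα : Continuous α)
    (hdiss : ∀ (x : P.A.domain) (u : U), fderiv ℝ V x (P.A x + P.B u) ≤
      P.cost x u - P.cost xe ue - (α ‖(x : H) - xe‖₊ : ℝ))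
    (x₀ : H) {u : ℝ → U} (hu : Continuous u) {t₁ t₂ : ℝ} (h₁ : 0 ≤ t₁) (h₁₂ : t₁ ≤ t₂) :
    V (P.S.mild x₀ (fun s => P.B (u s)) t₂) - V (P.S.mild x₀ (fun s => P.B (u s)) t₁) ≤
      ∫ t in t₁..t₂, (P.cost (P.S.mild x₀ (fun s => P.B (u s)) t) (u t) - P.cost xe ue
        - (α ‖P.S.mild x₀ (fun s => P.B (u s)) t - xe‖₊ : ℝ)) := by
  set f : ℝ → H := fun s => P.B (u s) with hf
  have hfc : Continuous f := P.B.continuous.comp hu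
  set m : ℝ → H := P.S.mild x₀ f with hm
  have hmc : Continuous m := P.S.continuous_mild _ hfc
  have hVd : Differentiable ℝ V := hV.differentiable one_ne_zero
  have hV' : Continuous (fderiv ℝ V) := hV.continuous_fderiv one_ne_zero
  -- The last term is the smoothing error: the averaged trajectory is driven by `S.avg h (f t)`,
  -- whereas the dissipation inequality is applied with `f t = B (u t)`. It vanishes at `h = 0`.
  set φ : ℝ → ℝ → ℝ := fun h t => P.cost (P.S.avg h (m t)) (u t) - P.cost xe ue
    - (α ‖P.S.avg h (m t) - xe‖₊ : ℝ)
    + fderiv ℝ V (P.S.avg h (m t)) (P.S.avg h (f t) - f t) with hφ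
  have hxc : Continuous fun p : ℝ × ℝ => P.S.avg p.1 (m p.2) :=
    P.S.continuous_avg_apply continuous_fst (hmc.comp continuous_snd)
  have hfc' : Continuous fun p : ℝ × ℝ => P.S.avg p.1 (f p.2) :=
    P.S.continuous_avg_apply continuous_fst (hfc.comp continuous_snd)
  have hφc : Continuous φ.uncurry :=
    (((P.continuous_cost hxc (hu.comp continuous_snd)).sub continuous_const).sub
      (continuous_rate hα hxc xe)).add
      ((hV'.comp hxc).clm_apply (hfc'.sub (hfc.comp continuous_snd)))
  have key : ∀ h : ℝ, 0 < h →
      V (P.S.avg h (m t₂)) - V (P.S.avg h (m t₁)) ≤ ∫ t in t₁..t₂, φ h t := by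
    intro h hh
    have hφh : Continuous (φ h) := hφc.uncurry_left h
    -- One-sided differentiability suffices for this form of the mean value inequality.
    refine intervalIntegral.sub_le_integral_of_hasDeriv_right_of_le
      (g := fun t => V (P.S.avg h (m t)))
      (g' := fun t => fderiv ℝ V (P.S.avg h (m t))
        (h⁻¹ • (P.S.ext h (m t) - m t) + P.S.avg h (f t))) h₁₂
      (hVd.continuous.comp ((P.S.avg h).continuous.comp hmc)).continuousOn
      (fun t ht => ?_) (hφh.integrableOn_Icc) (fun t ht => ?_)
    · have ht0 : 0 ≤ t := h₁.trans ht.1.le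
      refine (hVd (P.S.avg h (m t))).hasFDerivAt.comp_hasDerivWithinAt t ?_
      have hd := P.S.hasDerivWithinAt_mild (P.S.avg h x₀) (f := fun s => P.S.avg h (f s))
        ((P.S.avg h).continuous.comp hfc) ht0 (a := h⁻¹ • (P.S.ext h (m t) - m t)) (by
          rw [← P.S.avg_mild x₀ hfc hh.le ht0]
          exact P.S.tendsto_slope_avg hh (m t))
      refine hd.congr (fun s hs => ?_) ?_
      · exact P.S.avg_mild x₀ hfc hh.le (ht0.trans (le_of_lt (Set.mem_Ioi.1 hs)))
      · exact P.S.avg_mild x₀ hfc hh.le ht0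
    -- The averaged state lies in dom `A`, with image the difference quotient of the semigroup over
    -- time `h`; hence `hdiss` applies to it.
    · obtain ⟨y, hy, hAy⟩ := (P.A.mem_graph_iff).1
        (P.mem_graph_iff.2 (P.S.tendsto_slope_avg hh (m t)))
      simp only at hy hAy
      have hd := hdiss y (u t)
      rw [hAy, hy] at hd
      have hsplit : h⁻¹ • (P.S.ext h (m t) - m t) + P.S.avg h (f t) =
          (h⁻¹ • (P.S.ext h (m t) - m t) + P.B (u t)) + (P.S.avg h (f t) - f t) := by
        simp only [hf]
        abel
      rw [hsplit, _root_.map_add]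
      exact add_le_add_left hd _
  have hleft : Continuous fun h : ℝ => V (P.S.avg h (m t₂)) - V (P.S.avg h (m t₁)) :=
    (hVd.continuous.comp (P.S.continuous_avg_apply continuous_id continuous_const)).sub
      (hVd.continuous.comp (P.S.continuous_avg_apply continuous_id continuous_const))
  have hright : Continuous fun h : ℝ => ∫ t in t₁..t₂, φ h t :=
    intervalIntegral.continuous_parametric_intervalIntegral_of_continuous' hφc _ _
  have hlim := le_of_tendsto_of_tendsto
    ((hleft.tendsto 0).mono_left (nhdsWithin_le_nhds (s := Set.Ioi (0 : ℝ))))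
    ((hright.tendsto 0).mono_left nhdsWithin_le_nhds)
    (by filter_upwards [self_mem_nhdsWithin] with h hh using key h hh)
  simpa only [hφ, C0Semigroup.avg_zero_apply, sub_self, map_zero, add_zero] using hlim

end OCP

/-! ### Estimates and approximation for integrable inhomogeneities and square integrable controls.
-/

theorem norm_intervalIntegral_le_setIntegral_Icc {E : Type*} [NormedAddCommGroup E]
    [NormedSpace ℝ E] {w : ℝ → E} {F : ℝ → ℝ} {a b τ : ℝ} (ha : 0 ≤ a) (hab : a ≤ b) (hb : b ≤ τ)
    (hF : IntegrableOn F (Set.Icc 0 τ)) (hF0 : ∀ s, 0 ≤ F s)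
    (hw : ∀ s ∈ Set.Ioc a b, ‖w s‖ ≤ F s) :
    ‖∫ s in a..b, w s‖ ≤ ∫ s in Set.Icc 0 τ, F s := by
  have hsub : Set.Ioc a b ⊆ Set.Icc 0 τ := fun s hs => ⟨ha.trans hs.1.le, hs.2.trans hb⟩
  refine (intervalIntegral.norm_integral_le_of_norm_le hab (Eventually.of_forall hw)
    ((intervalIntegrable_iff_integrableOn_Ioc_of_le hab).2 (hF.mono_set hsub))).trans ?_
  rw [intervalIntegral.integral_of_le hab]
  exact setIntegral_mono_set hF (Eventually.of_forall hF0) (LE.le.eventuallyLE hsub)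

/-- Postcomposition with a continuous map preserves uniform convergence to a map with compact
range. -/
theorem _root_.TendstoUniformlyOn.continuous_comp_of_isCompact_image {ι X E F : Type*}
    [UniformSpace E] [UniformSpace F] {l : Filter ι} {x : ι → X → E} {y : X → E} {s : Set X}
    (h : TendstoUniformlyOn x y l s) (hs : IsCompact (y '' s)) {G : E → F} (hG : Continuous G) :
    TendstoUniformlyOn (fun n t => G (x n t)) (fun t => G (y t)) l s := fun _ hr =>
  (h _ (hs.uniformContinuousAt_of_continuousAt G (fun _ _ => hG.continuousAt) hr)).mono
    fun _ hn t ht => hn t ht (Set.mem_image_of_mem y ht)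

namespace C0Semigroup

variable {𝕜 H : Type*} [RCLike 𝕜] [NormedAddCommGroup H] [InnerProductSpace 𝕜 H]
  [NormedSpace ℝ H] [IsScalarTower ℝ 𝕜 H] [CompleteSpace H]

theorem intervalIntegrable_ext_sub (S : C0Semigroup 𝕜 H) {f : ℝ → H} {τ t : ℝ}
    (hf : IntegrableOn f (Set.Icc 0 τ)) (ht : t ∈ Set.Icc 0 τ) :
    IntervalIntegrable (fun s => S.ext (t - s) (f s)) volume 0 t := by
  obtain ⟨M, -, hM⟩ := S.exists_ext_bound τ
  rw [intervalIntegrable_iff_integrableOn_Ioc_of_le ht.1]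
  have hf' : IntegrableOn f (Set.Ioc 0 t) := hf.mono_set fun s hs => ⟨hs.1.le, hs.2.trans ht.2⟩
  refine Integrable.mono' (hf'.norm.const_mul M) ?_ ?_
  · exact S.continuous_ext.comp_aestronglyMeasurable
      ((continuous_const.sub continuous_id).aestronglyMeasurable.prodMk hf'.aestronglyMeasurable)
  · filter_upwards [ae_restrict_mem measurableSet_Ioc] with s hs
    exact hM _ (by linarith [hs.1, ht.2]) _

/-- Mild solutions depend Lipschitz continuously on the inhomogeneity, in `L¹`. -/
theorem norm_mild_sub_mild_le (S : C0Semigroup 𝕜 H) (τ : ℝ) :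
    ∃ M : ℝ, 0 ≤ M ∧ ∀ (x₀ : H) (f g : ℝ → H), IntegrableOn f (Set.Icc 0 τ) →
      IntegrableOn g (Set.Icc 0 τ) → ∀ t ∈ Set.Icc 0 τ,
        ‖S.mild x₀ f t - S.mild x₀ g t‖ ≤ M * ∫ s in Set.Icc 0 τ, ‖f s - g s‖ := by
  obtain ⟨M, hM0, hM⟩ := S.exists_ext_bound τ
  refine ⟨M, hM0, fun x₀ f g hf hg t ht => ?_⟩
  rw [mild, mild, add_sub_add_left_eq_sub, ← intervalIntegral.integral_sub
    (S.intervalIntegrable_ext_sub hf ht) (S.intervalIntegrable_ext_sub hg ht),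
    ← integral_const_mul]
  refine norm_intervalIntegral_le_setIntegral_Icc le_rfl ht.1 ht.2
    ((hf.sub hg).norm.const_mul M) (fun s => by positivity) fun s hs => ?_
  rw [← map_sub]
  exact hM _ (by linarith [hs.1, ht.2]) _

/-- Continuous functions are dense in L¹ and mild solutions depend on `f` in a Lipschitz way, so the
solution is a uniform limit of continuous ones. -/
theorem continuousOn_mild (S : C0Semigroup 𝕜 H) (x₀ : H) {f : ℝ → H} {τ : ℝ}
    (hf : IntegrableOn f (Set.Icc 0 τ)) : ContinuousOn (S.mild x₀ f) (Set.Icc 0 τ) := by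
  obtain ⟨M, hM0, hM⟩ := S.norm_mild_sub_mild_le τ
  refine continuousOn_of_uniform_approx_of_continuousOn fun r hr => ?_
  obtain ⟨ε, hε, hεr⟩ := Metric.mem_uniformity_dist.1 hr
  obtain ⟨g, hg, hgi⟩ := Integrable.exists_boundedContinuous_integral_sub_le hf
    (show 0 < ε / (M + 1) by positivity)
  refine ⟨S.mild x₀ g, (S.continuous_mild x₀ g.continuous).continuousOn, fun t ht => hεr ?_⟩
  rw [dist_eq_norm]
  calc ‖S.mild x₀ f t - S.mild x₀ g t‖ ≤ M * (ε / (M + 1)) :=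
        (hM x₀ f g hf hgi t ht).trans (mul_le_mul_of_nonneg_left hg hM0)
    _ < ε := by
        rw [mul_div_assoc', div_lt_iff₀ (by positivity)]
        nlinarith

end C0Semigroup

/-- Approximation of a square integrable control by continuous ones. -/
theorem exists_continuous_integral_sq_norm_sub_le {U : Type*} [NormedAddCommGroup U]
    [NormedSpace ℝ U] {u : ℝ → U} {s : Set ℝ} [IsFiniteMeasure (volume.restrict s)]
    (hu : MemLp u 2 (volume.restrict s)) {δ : ℝ} (hδ : 0 < δ) :
    ∃ g : ℝ → U, Continuous g ∧ MemLp g 2 (volume.restrict s) ∧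
      ∫ t in s, ‖g t - u t‖ ^ 2 ≤ δ := by
  have h2 : ENNReal.ofReal 2 = 2 := by simp
  rw [← h2] at hu
  obtain ⟨g, hg, hgm⟩ := hu.exists_boundedContinuous_integral_rpow_sub_le two_pos hδ
  rw [h2] at hgm
  refine ⟨g, g.continuous, hgm, ?_⟩
  simpa [norm_sub_rev] using hg

/-! ### The control part of the cost under L² convergence. -/

namespace OCP

variable {𝕜 H U Y Z : Type*} [RCLike 𝕜]
  [NormedAddCommGroup H] [InnerProductSpace 𝕜 H] [NormedSpace ℝ H]
  [NormedAddCommGroup U] [InnerProductSpace 𝕜 U]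
  [NormedAddCommGroup Y] [InnerProductSpace 𝕜 Y]
  [NormedAddCommGroup Z] [InnerProductSpace 𝕜 Z]

theorem cost_eq_add (P : OCP 𝕜 H U Y Z) (x : H) (u : U) :
    P.cost x u = P.cost x 0 + P.cost 0 u := by
  simp [cost]
  ring

/-- Young's inequality with weight `δ` splits the cross terms, replacing Cauchy–Schwarz for
integrals. With `δ` a bound for the L² distance of the controls, the integral of `δ⁻¹ * ‖a - b‖ ^ 2`
is still at most `δ`. -/
theorem abs_cost_zero_sub_le (P : OCP 𝕜 H U Y Z) (a b : U) {δ : ℝ} (hδ : 0 < δ) :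
    |P.cost 0 a - P.cost 0 b| ≤ ‖P.K‖ ^ 2 * ‖a - b‖ ^ 2
      + ‖P.K‖ ^ 2 * (δ * ‖b‖ ^ 2 + δ⁻¹ * ‖a - b‖ ^ 2) + ‖P.v‖ * (δ + δ⁻¹ * ‖a - b‖ ^ 2) := by
  have young (p q : ℝ) : 2 * (p * q) ≤ δ * p ^ 2 + δ⁻¹ * q ^ 2 := by
    have h : 0 ≤ δ⁻¹ * (δ * p - q) ^ 2 := by positivity
    have h' : δ⁻¹ * (δ * p - q) ^ 2 = δ * p ^ 2 + δ⁻¹ * q ^ 2 - 2 * (p * q) := by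
      field_simp
      ring
    linarith
  have hK : |‖P.K a‖ ^ 2 - ‖P.K b‖ ^ 2| ≤
      ‖P.K‖ ^ 2 * ‖a - b‖ ^ 2 + ‖P.K‖ ^ 2 * (2 * (‖b‖ * ‖a - b‖)) := by
    have h₁ : |‖P.K a‖ - ‖P.K b‖| ≤ ‖P.K‖ * ‖a - b‖ :=
      (abs_norm_sub_norm_le _ _).trans (by rw [← map_sub]; exact P.K.le_opNorm _)
    have h₂ : ‖P.K b‖ ≤ ‖P.K‖ * ‖b‖ := P.K.le_opNorm b
    have h₃ : ‖P.K a‖ ^ 2 - ‖P.K b‖ ^ 2 =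
        (‖P.K a‖ - ‖P.K b‖) * ((‖P.K a‖ - ‖P.K b‖) + 2 * ‖P.K b‖) := by ring
    have h₄ : |(‖P.K a‖ - ‖P.K b‖) + 2 * ‖P.K b‖| ≤ ‖P.K‖ * ‖a - b‖ + 2 * (‖P.K‖ * ‖b‖) := by
      refine (abs_add_le _ _).trans (add_le_add h₁ ?_)
      rw [abs_of_nonneg (by positivity)]
      linarith
    rw [h₃, abs_mul]
    refine (mul_le_mul h₁ h₄ (abs_nonneg _) (by positivity)).trans (le_of_eq ?_)
    ring
  have hv : |2 * RCLike.re (inner 𝕜 P.v a) - 2 * RCLike.re (inner 𝕜 P.v b)| ≤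
      ‖P.v‖ * (2 * (1 * ‖a - b‖)) := by
    rw [← mul_sub, ← map_sub, ← inner_sub_right, abs_mul, abs_two]
    have := (RCLike.abs_re_le_norm (inner 𝕜 P.v (a - b))).trans (norm_inner_le_norm P.v (a - b))
    linarith
  have hsplit : P.cost 0 a - P.cost 0 b = (‖P.K a‖ ^ 2 - ‖P.K b‖ ^ 2)
      + (2 * RCLike.re (inner 𝕜 P.v a) - 2 * RCLike.re (inner 𝕜 P.v b)) := by
    simp [cost]
    ring
  rw [hsplit]
  refine (abs_add_le _ _).trans (add_le_add (hK.trans ?_) (hv.trans ?_))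
  · gcongr
    exact young _ _
  · gcongr
    simpa using young 1 ‖a - b‖

theorem integrable_cost_zero (P : OCP 𝕜 H U Y Z) {μ : Measure ℝ} [IsFiniteMeasure μ] {u : ℝ → U}
    (hu : MemLp u 2 μ) : Integrable (fun t => P.cost 0 (u t)) μ := by
  have hsq : Integrable (fun t => ‖u t‖ ^ 2) μ := hu.integrable_norm_pow two_ne_zero
  have hbound : Integrable (fun t => ‖P.K‖ ^ 2 * ‖u t‖ ^ 2 + ‖P.K‖ ^ 2 * ‖u t‖ ^ 2
      + ‖P.v‖ * (1 + ‖u t‖ ^ 2)) μ :=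
    ((hsq.const_mul _).add (hsq.const_mul _)).add (((integrable_const _).add hsq).const_mul _)
  refine hbound.mono' ((P.continuous_cost continuous_const
    continuous_id).comp_aestronglyMeasurable hu.aestronglyMeasurable)
    (Eventually.of_forall fun t => ?_)
  have h0 : P.cost (0 : H) (0 : U) = 0 := by simp [cost]
  simpa [h0] using P.abs_cost_zero_sub_le (u t) 0 one_pos

/-- Convergence of controls in `L²` implies convergence of the part of the cost that depends on
the control. -/
theorem tendsto_integral_cost_zero (P : OCP 𝕜 H U Y Z) {u : ℝ → U} {g : ℕ → ℝ → U} {τ : ℝ}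
    (hu : MemLp u 2 (volume.restrict (Set.Icc 0 τ)))
    (hg : ∀ n, MemLp (g n) 2 (volume.restrict (Set.Icc 0 τ))) {δ : ℕ → ℝ} (hδ : ∀ n, 0 < δ n)
    (hδ0 : Tendsto δ atTop (𝓝 0))
    (hgu : ∀ n, ∫ t in Set.Icc 0 τ, ‖g n t - u t‖ ^ 2 ≤ δ n ^ 2) {a b : ℝ} (ha : 0 ≤ a)
    (hab : a ≤ b) (hb : b ≤ τ) :
    Tendsto (fun n => ∫ t in a..b, P.cost 0 (g n t)) atTop (𝓝 (∫ t in a..b, P.cost 0 (u t))) := by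
  have hsub : Set.Ioc a b ⊆ Set.Icc 0 τ := fun s hs => ⟨ha.trans hs.1.le, hs.2.trans hb⟩
  have hint {w : ℝ → U} (hw : MemLp w 2 (volume.restrict (Set.Icc 0 τ))) :
      IntervalIntegrable (fun t => P.cost 0 (w t)) volume a b :=
    (intervalIntegrable_iff_integrableOn_Ioc_of_le hab).2
      (IntegrableOn.mono_set (P.integrable_cost_zero hw) hsub)
  set N := ∫ t in Set.Icc 0 τ, ‖u t‖ ^ 2
  set L : ℝ := volume.real (Set.Icc 0 τ)
  rw [tendsto_iff_norm_sub_tendsto_zero]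
  have hlim : Tendsto (fun n => ‖P.K‖ ^ 2 * δ n ^ 2 + ‖P.K‖ ^ 2 * (δ n * N + δ n)
      + ‖P.v‖ * (δ n * L + δ n)) atTop (𝓝 0) := by
    have hc : Continuous fun r : ℝ => ‖P.K‖ ^ 2 * r ^ 2 + ‖P.K‖ ^ 2 * (r * N + r)
      + ‖P.v‖ * (r * L + r) := by fun_prop
    simpa [Function.comp_def] using (hc.tendsto 0).comp hδ0
  refine squeeze_zero (fun _ => norm_nonneg _) (fun n => ?_) hlim
  have hd : Integrable (fun t => ‖g n t - u t‖ ^ 2) (volume.restrict (Set.Icc 0 τ)) :=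
    ((hg n).sub hu).integrable_norm_pow two_ne_zero
  have hu2 : Integrable (fun t => ‖u t‖ ^ 2) (volume.restrict (Set.Icc 0 τ)) :=
    hu.integrable_norm_pow two_ne_zero
  have hi₁ := hd.const_mul (‖P.K‖ ^ 2)
  have hi₂ : Integrable (fun t => ‖P.K‖ ^ 2 * (δ n * ‖u t‖ ^ 2 + (δ n)⁻¹ * ‖g n t - u t‖ ^ 2))
      (volume.restrict (Set.Icc 0 τ)) :=
    ((hu2.const_mul (δ n)).add (hd.const_mul (δ n)⁻¹)).const_mul (‖P.K‖ ^ 2)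
  have hi₃ : Integrable (fun t => ‖P.v‖ * (δ n + (δ n)⁻¹ * ‖g n t - u t‖ ^ 2))
      (volume.restrict (Set.Icc 0 τ)) :=
    ((integrable_const (δ n)).add (hd.const_mul (δ n)⁻¹)).const_mul ‖P.v‖
  have hi₁₂ : Integrable (fun t => ‖P.K‖ ^ 2 * ‖g n t - u t‖ ^ 2
      + ‖P.K‖ ^ 2 * (δ n * ‖u t‖ ^ 2 + (δ n)⁻¹ * ‖g n t - u t‖ ^ 2))
      (volume.restrict (Set.Icc 0 τ)) := hi₁.add hi₂
  rw [← intervalIntegral.integral_sub (hint (hg n)) (hint hu)]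
  have hδn := hδ n
  refine (norm_intervalIntegral_le_setIntegral_Icc ha hab hb (hi₁₂.add hi₃)
    (fun s => by simp only [Pi.add_apply]; positivity)
    fun s _ => P.abs_cost_zero_sub_le (g n s) (u s) hδn).trans ?_
  -- This is why the squared L² error is required to be at most `δ n ^ 2` rather than `δ n`.
  have hq : (δ n)⁻¹ * ∫ t in Set.Icc 0 τ, ‖g n t - u t‖ ^ 2 ≤ δ n := by
    rw [inv_mul_le_iff₀ hδn, ← sq]
    exact hgu n
  simp only [Pi.add_apply]
  rw [integral_add hi₁₂ hi₃, integral_add hi₁ hi₂, integral_const_mul, integral_const_mul,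
    integral_const_mul, integral_add (hu2.const_mul _) (hd.const_mul _),
    integral_add (integrable_const _) (hd.const_mul _), integral_const_mul, integral_const_mul,
    integral_const, measureReal_restrict_apply_univ, smul_eq_mul, mul_comm L]
  gcongr
  exact hgu n

end OCP

/-! ### Passage to the limit for square integrable controls. -/

namespace OCP

variable {𝕜 H U Y Z : Type*} [RCLike 𝕜]
  [NormedAddCommGroup H] [InnerProductSpace 𝕜 H] [NormedSpace ℝ H] [IsScalarTower ℝ 𝕜 H]
  [CompleteSpace H]
  [NormedAddCommGroup U] [InnerProductSpace 𝕜 U]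
  [NormedAddCommGroup Y] [InnerProductSpace 𝕜 Y]
  [NormedAddCommGroup Z] [InnerProductSpace 𝕜 Z]

/-- Convergence of controls in `L²` implies uniform convergence of the mild solutions. -/
theorem tendstoUniformlyOn_mild (P : OCP 𝕜 H U Y Z) (x₀ : H) {u : ℝ → U} {g : ℕ → ℝ → U} {τ : ℝ}
    (hu : MemLp u 2 (volume.restrict (Set.Icc 0 τ)))
    (hg : ∀ n, MemLp (g n) 2 (volume.restrict (Set.Icc 0 τ))) {δ : ℕ → ℝ} (hδ : ∀ n, 0 < δ n)
    (hδ0 : Tendsto δ atTop (𝓝 0))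
    (hgu : ∀ n, ∫ t in Set.Icc 0 τ, ‖g n t - u t‖ ^ 2 ≤ δ n ^ 2) :
    TendstoUniformlyOn (fun n => P.S.mild x₀ fun s => P.B (g n s)) (P.S.mild x₀ fun s => P.B (u s))
      atTop (Set.Icc 0 τ) := by
  obtain ⟨M, hM0, hM⟩ := P.S.norm_mild_sub_mild_le τ
  have hint {w : ℝ → U} (hw : MemLp w 2 (volume.restrict (Set.Icc 0 τ))) :
      IntegrableOn (fun s => P.B (w s)) (Set.Icc 0 τ) :=
    P.B.integrable_comp (hw.integrable (by norm_num))
  set L : ℝ := volume.real (Set.Icc 0 τ)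
  have hlim : Tendsto (fun n => M * (‖P.B‖ * (δ n * L + δ n))) atTop (𝓝 0) := by
    have hc : Continuous fun r : ℝ => M * (‖P.B‖ * (r * L + r)) := by fun_prop
    simpa [Function.comp_def] using (hc.tendsto 0).comp hδ0
  rw [Metric.tendstoUniformlyOn_iff]
  intro ε hε
  filter_upwards [hlim.eventually_lt_const hε] with n hn t ht
  rw [dist_comm, dist_eq_norm]
  refine lt_of_le_of_lt ((hM x₀ _ _ (hint (hg n)) (hint hu) t ht).trans ?_) hn
  refine mul_le_mul_of_nonneg_left ?_ hM0
  have hδn := hδ n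
  have hd : Integrable (fun t => ‖g n t - u t‖ ^ 2) (volume.restrict (Set.Icc 0 τ)) :=
    ((hg n).sub hu).integrable_norm_pow two_ne_zero
  have hi : Integrable (fun t => ‖P.B‖ * (δ n + (δ n)⁻¹ * ‖g n t - u t‖ ^ 2))
      (volume.restrict (Set.Icc 0 τ)) :=
    ((integrable_const (δ n)).add (hd.const_mul (δ n)⁻¹)).const_mul ‖P.B‖
  have hq : (δ n)⁻¹ * ∫ t in Set.Icc 0 τ, ‖g n t - u t‖ ^ 2 ≤ δ n := by
    rw [inv_mul_le_iff₀ hδn, ← sq]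
    exact hgu n
  calc ∫ s in Set.Icc 0 τ, ‖P.B (g n s) - P.B (u s)‖
      ≤ ∫ s in Set.Icc 0 τ, ‖P.B‖ * (δ n + (δ n)⁻¹ * ‖g n s - u s‖ ^ 2) := by
        refine integral_mono ((hint (hg n)).sub (hint hu)).norm hi fun s => ?_
        simp only [← map_sub]
        refine (P.B.le_opNorm _).trans (mul_le_mul_of_nonneg_left ?_ (norm_nonneg _))
        set r := ‖g n s - u s‖
        -- Completing the square gives `r ≤ δ n + (δ n)⁻¹ * r ^ 2`, which bounds the L¹ error by L²
        -- data.
        have h : δ n + (δ n)⁻¹ * r ^ 2 - r = (δ n)⁻¹ * ((δ n - r / 2) ^ 2 + 3 / 4 * r ^ 2) := by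
          field_simp
          ring
        have h' : 0 ≤ (δ n)⁻¹ * ((δ n - r / 2) ^ 2 + 3 / 4 * r ^ 2) := by positivity
        linarith
    _ ≤ ‖P.B‖ * (δ n * L + δ n) := by
        rw [integral_const_mul, integral_add (integrable_const _) (hd.const_mul _),
          integral_const_mul, integral_const, measureReal_restrict_apply_univ, smul_eq_mul,
          mul_comm _ (δ n)]
        gcongr

/-- The infinitesimal dissipation inequality implies the one along all trajectories. -/
theorem integral_dissipation_of_memLp (P : OCP 𝕜 H U Y Z) {xe : H} {ue : U} {V : H → ℝ}
    {α : ℝ≥0 → ℝ≥0} (hV : ContDiff ℝ 1 V) (hα : Continuous α)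
    (hdiss : ∀ (x : P.A.domain) (u : U), fderiv ℝ V x (P.A x + P.B u) ≤
      P.cost x u - P.cost xe ue - (α ‖(x : H) - xe‖₊ : ℝ))
    (x₀ : H) {u : ℝ → U} {t₁ t₂ : ℝ} (hu : MemLp u 2 (volume.restrict (Set.Icc 0 t₂)))
    (h₁ : 0 ≤ t₁) (h₁₂ : t₁ ≤ t₂) :
    V (P.S.mild x₀ (fun s => P.B (u s)) t₂) - V (P.S.mild x₀ (fun s => P.B (u s)) t₁) ≤
      ∫ t in t₁..t₂, (P.cost (P.S.mild x₀ (fun s => P.B (u s)) t) (u t) - P.cost xe ue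
        - (α ‖P.S.mild x₀ (fun s => P.B (u s)) t - xe‖₊ : ℝ)) := by
  let _ : NormedSpace ℝ U := NormedSpace.restrictScalars ℝ 𝕜 U
  set δ : ℕ → ℝ := fun n => 1 / ((n : ℝ) + 1)
  have hδ (n : ℕ) : 0 < δ n := by positivity
  have hδ0 : Tendsto δ atTop (𝓝 0) := tendsto_one_div_add_atTop_nhds_zero_nat
  choose g hgc hgm hgu using fun n =>
    exists_continuous_integral_sq_norm_sub_le hu (pow_pos (hδ n) 2)
  set m : ℝ → H := P.S.mild x₀ fun s => P.B (u s) with hm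
  set x : ℕ → ℝ → H := fun n => P.S.mild x₀ fun s => P.B (g n s) with hx
  have hxc (n : ℕ) : Continuous (x n) := P.S.continuous_mild x₀ (P.B.continuous.comp (hgc n))
  have hmc : ContinuousOn m (Set.Icc 0 t₂) :=
    P.S.continuousOn_mild x₀ (P.B.integrable_comp (hu.integrable (by norm_num)))
  have hunif : TendstoUniformlyOn x m atTop (Set.Icc 0 t₂) :=
    P.tendstoUniformlyOn_mild x₀ hu hgm hδ hδ0 hgu
  -- `G` collects all terms of the integrand that depend on the state alone, together with the
  -- constant.
  set G : H → ℝ := fun y => P.cost y 0 - P.cost xe ue - (α ‖y - xe‖₊ : ℝ) with hG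
  have hGc : Continuous G :=
    ((P.continuous_cost continuous_id continuous_const).sub continuous_const).sub
      (continuous_rate hα continuous_id xe)
  have hsub : Set.uIcc t₁ t₂ ⊆ Set.Icc 0 t₂ := by
    rw [Set.uIcc_of_le h₁₂]
    exact Set.Icc_subset_Icc_left h₁
  -- Bounded sets of `H` need not be relatively compact, but the limit trajectory over `[t₁, t₂]`
  -- has compact range, so continuity of `G` suffices for uniform convergence.
  have hGlim : Tendsto (fun n => ∫ t in t₁..t₂, G (x n t)) atTop (𝓝 (∫ t in t₁..t₂, G (m t))) :=
    TendstoUniformlyOn.tendsto_intervalIntegral_of_continuousOn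
      (Eventually.of_forall fun n => (hGc.comp (hxc n)).continuousOn)
      ((hunif.mono hsub).continuous_comp_of_isCompact_image
        (isCompact_uIcc.image_of_continuousOn (hmc.mono hsub)) hGc)
  have hqlim := P.tendsto_integral_cost_zero hu hgm hδ hδ0 hgu h₁ h₁₂ le_rfl
  have hqint {w : ℝ → U} (hw : MemLp w 2 (volume.restrict (Set.Icc 0 t₂))) :
      IntervalIntegrable (fun t => P.cost 0 (w t)) volume t₁ t₂ :=
    (intervalIntegrable_iff_integrableOn_Ioc_of_le h₁₂).2
      (IntegrableOn.mono_set (P.integrable_cost_zero hw)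
        fun s hs => ⟨h₁.trans hs.1.le, hs.2⟩)
  have hsplit {y : ℝ → H} {w : ℝ → U} (hy : ContinuousOn y (Set.Icc 0 t₂))
      (hw : MemLp w 2 (volume.restrict (Set.Icc 0 t₂))) :
      ∫ t in t₁..t₂, (P.cost (y t) (w t) - P.cost xe ue - (α ‖y t - xe‖₊ : ℝ)) =
        (∫ t in t₁..t₂, G (y t)) + ∫ t in t₁..t₂, P.cost 0 (w t) := by
    have hGint : IntervalIntegrable (fun t => G (y t)) volume t₁ t₂ :=
      (hGc.comp_continuousOn (hy.mono hsub)).intervalIntegrable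
    rw [← intervalIntegral.integral_add hGint (hqint hw)]
    refine intervalIntegral.integral_congr fun t _ => ?_
    simp only [hG, P.cost_eq_add (y t) (w t)]
    ring
  have hVlim {t : ℝ} (ht : t ∈ Set.Icc 0 t₂) :
      Tendsto (fun n => V (x n t)) atTop (𝓝 (V (m t))) :=
    (hV.continuous.tendsto _).comp (hunif.tendsto_at ht)
  rw [hsplit hmc hu]
  refine le_of_tendsto_of_tendsto' ((hVlim ⟨h₁.trans h₁₂, le_rfl⟩).sub (hVlim ⟨h₁, h₁₂⟩))
    (hGlim.add hqlim) fun n => ?_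
  rw [← hsplit (hxc n).continuousOn (hgm n)]
  exact P.integral_dissipation_of_continuous hV hα hdiss x₀ (hgc n) h₁ h₁₂

end OCP

end LQ

end

/-! ### The equivalence. -/

theorem lemma3p3 {𝕜 H U Y Z : Type*} [RCLike 𝕜]
    [NormedAddCommGroup H] [InnerProductSpace 𝕜 H] [CompleteSpace H]
    [NormedSpace ℝ H] [IsScalarTower ℝ 𝕜 H]
    [NormedAddCommGroup U] [InnerProductSpace 𝕜 U] [CompleteSpace U]
    [NormedAddCommGroup Y] [InnerProductSpace 𝕜 Y] [CompleteSpace Y]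
    [NormedAddCommGroup Z] [InnerProductSpace 𝕜 Z] [CompleteSpace Z]
    (P : LQ.OCP 𝕜 H U Y Z) (xe : H) (ue : U) (he : P.IsControlledEquilibrium xe ue)
    (V : H → ℝ) (hV : LQ.IsStorageFunction V) (α : ℝ≥0 → ℝ≥0) (hα : LQ.ClassK α) :
    P.IsStrictlyPreDissipativeWith xe ue V α ↔
      ∀ (x₀ : H) (u : ℝ → U), LQ.IsL2Loc u → ∀ t₁ t₂ : ℝ, 0 ≤ t₁ → t₁ < t₂ →
        V (P.mildSolution u x₀ t₂) - V (P.mildSolution u x₀ t₁) ≤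
          ∫ t in t₁..t₂, (P.cost (P.mildSolution u x₀ t) (u t) - P.cost xe ue
            - (α ‖P.mildSolution u x₀ t - xe‖₊ : ℝ)) := by
  constructor
  · intro h x₀ u hu t₁ t₂ h₁ h₁₂
    have key := P.integral_dissipation_of_memLp hV hα.continuous h.dissipation x₀ (hu t₂) h₁ h₁₂.le
    rw [P.mildSolution_eq_mild u x₀ h₁, P.mildSolution_eq_mild u x₀ (h₁.trans h₁₂.le)]
    refine key.trans_eq (intervalIntegral.integral_congr fun t ht => ?_)
    rw [Set.uIcc_of_le h₁₂.le] at ht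
    simp only [P.mildSolution_eq_mild u x₀ (h₁.trans ht.1)]
  · intro h
    refine ⟨he, hV, hα, fun x u => ?_⟩
    exact P.fderiv_le_of_integral_dissipation (hV.differentiable one_ne_zero) hα.continuous x u
      fun t ht => h x (fun _ => u) (fun τ => memLp_const u) 0 t le_rfl ht
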